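/- A (simple, finite) mixed graph has a finite vertex set, undirected edges and directed arcs, without loops, and any two distinct vertices are joined by at most one edge or arc (so no edge is parallel to an arc, and no two arcs are opposite). A walk may use an edge in either direction and an arc only from its tail to its head; a cycle of length $n\ge 3$ is a closed walk $(v_0,v_1,\dots,v_n=v_0)$ with $v_0,\dots,v_{n-1}$ distinct, and the girth is the length of a shortest cycle. A $[z,r;g]$-mixed graph is a mixed graph of girth $g$ in which every vertex is the tail of exactly $z$ arcs, the head of exactly $z$ arcs and incident with exactly $r$ edges. A $[z,r;g]$-mixed cage is a $[z,r;g]$-mixed graph with the minimum number of vertices. **Theorem.** Let $z\in\{1,2\}$ and let $r,g$ be non-negative integers. The underlying undirected graph of every $[z,r;g]$-mixed cage is 2-connected: it has at least three vertices, is connected, and remains connected after the deletion of any single vertex. -/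

import Mathlib

universe u

/-- A simple mixed graph on the vertex set `V`: undirected edges, given by a simple graph, and
directed arcs `Arc u v` from `u` to `v`. There are no loops, and two distinct vertices are joined
by at most one object (an edge, or an arc in one of the two directions). -/
structure MixedGraph (V : Type u) where
  edges : SimpleGraph V
  Arc : V → V → Prop
  arc_asymm : ∀ ⦃u v : V⦄, Arc u v → ¬ Arc v u
  arc_not_edge : ∀ ⦃u v : V⦄, Arc u v → ¬ edges.Adj u v

namespace MixedGraph

/-- One step of a walk: along an edge in either direction, or along an arc from its tail to its
head. -/
def Step {V : Type u} (G : MixedGraph V) (u v : V) : Prop :=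
  G.edges.Adj u v ∨ G.Arc u v

/-- `p 0, p 1, …, p n` is a cycle of length `n`: a closed walk of length `n ≥ 3` whose vertices
`p 0, …, p (n - 1)` are distinct. (In a simple mixed graph there is no shorter cycle: a closed walk
of length two can only run along one edge and back.) -/
def IsCycle {V : Type u} (G : MixedGraph V) (n : ℕ) (p : ℕ → V) : Prop :=
  3 ≤ n ∧ p n = p 0 ∧ (∀ i < n, G.Step (p i) (p (i + 1))) ∧ Set.InjOn p (Set.Iio n)

/-- The girth: the length of a shortest cycle, `⊤` if there is no cycle. -/
noncomputable def girth {V : Type u} (G : MixedGraph V) : ℕ∞ :=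
  ⨅ (n : ℕ) (_ : ∃ p : ℕ → V, G.IsCycle n p), (n : ℕ∞)

/-- Every vertex is the tail of `z` arcs, the head of `z` arcs and incident with `r` edges. -/
def IsRegular {V : Type u} (G : MixedGraph V) (z r : ℕ) : Prop :=
  ∀ v : V, {w : V | G.Arc v w}.ncard = z ∧ {w : V | G.Arc w v}.ncard = z ∧
    {w : V | G.edges.Adj v w}.ncard = r

/-- `[z, r; g]`-mixed graphs. -/
def IsMixedRegularGraph {V : Type u} (G : MixedGraph V) (z r g : ℕ) : Prop :=
  Finite V ∧ G.IsRegular z r ∧ G.girth = g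

/-- `[z, r; g]`-mixed cages: `[z, r; g]`-mixed graphs of minimum order. (Every finite order is
realized by a type in the universe of `V`, so comparing within that universe loses nothing.) -/
def IsMixedCage {V : Type u} (G : MixedGraph V) (z r g : ℕ) : Prop :=
  G.IsMixedRegularGraph z r g ∧
    ∀ (W : Type u) (H : MixedGraph W), H.IsMixedRegularGraph z r g → Nat.card V ≤ Nat.card W

/-- The underlying undirected graph: every arc is replaced by an edge. -/
def underlying {V : Type u} (G : MixedGraph V) : SimpleGraph V where
  Adj u v := G.edges.Adj u v ∨ G.Arc u v ∨ G.Arc v u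
  symm := ⟨by
    rintro u v (h | h | h)
    · exact Or.inl h.symm
    · exact Or.inr (Or.inr h)
    · exact Or.inr (Or.inl h)⟩
  loopless := ⟨by
    rintro v (h | h | h)
    · exact G.edges.loopless.irrefl v h
    · exact G.arc_asymm h h
    · exact G.arc_asymm h h⟩

end MixedGraph

/-- A (finite) graph is 2-connected if it has at least three vertices, is connected, and stays
connected when any single vertex is deleted. -/
def IsTwoConnected {V : Type u} (G : SimpleGraph V) : Prop :=
  3 ≤ Nat.card V ∧ G.Connected ∧ ∀ v : V, (G.induce {w : V | w ≠ v}).Connected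

namespace MixedGraph

/-! ### Closed walks and cycles. -/

variable {V W : Type u} {G : MixedGraph V}

/-! Suppose deleting `v` from a cage disconnects it. Some component `S` of the rest has fewer than
half of all vertices. Take two copies of `S` and replace the lost connections to `v` by connections
between the copies (`exists_double`). Degrees are preserved and the girth does not drop below `g`,
but the order `2|S|` is smaller than that of the cage.

The girth of the double may exceed `g`, so minimality must extend to regular graphs of girth at
least `g` (`IsMixedCage.card_le`). If the girth exceeds `g`, delete a vertex (`r` even) or the two
ends of an edge (`r` odd) and reconnect the neighbours: the order falls while the girth stays at
least `g` (`exists_smaller`). Iterating reaches girth exactly `g`. The restriction on `z` enters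
here: the new arcs must avoid the old ones and each other, which is a matching problem between sets
of size `z`.

Both constructions are instances of `Splice`, and `Splice.cycle_cases` controls the girth: the
stretch of a cycle between consecutive new steps closes up in the old graph through the deleted
vertices. -/

theorem Step.ne {u v : V} (h : G.Step u v) : u ≠ v := by
  rintro rfl
  rcases h with h | h
  · exact G.edges.loopless.irrefl _ h
  · exact G.arc_asymm h h

theorem IsCycle.girth_le {n : ℕ} {p : ℕ → V} (h : G.IsCycle n p) : G.girth ≤ n :=
  iInf₂_le n ⟨p, h⟩

theorem le_girth {k : ℕ} (h : ∀ n p, G.IsCycle n p → k ≤ n) : (k : ℕ∞) ≤ G.girth :=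
  le_iInf₂ fun n ⟨p, hp⟩ => by exact_mod_cast h n p hp

theorem three_le_girth (G : MixedGraph V) : (3 : ℕ∞) ≤ G.girth :=
  le_girth (k := 3) fun _ _ h => h.1

/-- A closed walk that never reverses immediately contains a cycle. -/
theorem girth_le_of_closed_walk (t : ℕ → V) {N : ℕ} (hN : 1 ≤ N) (hc : t N = t 0)
    (hs : ∀ i < N, G.Step (t i) (t (i + 1))) (hb : ∀ i, i + 2 ≤ N → t i ≠ t (i + 2)) :
    G.girth ≤ N := by
  classical
  -- The shortest gap between two equal entries bounds a cycle; steps and non-reversal exclude gaps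
  -- 1 and 2.
  have hex : ∃ d, 1 ≤ d ∧ ∃ i, i + d ≤ N ∧ t i = t (i + d) := ⟨N, hN, 0, by omega, by simp [hc]⟩
  obtain ⟨h1, i, hi, he⟩ := Nat.find_spec hex
  have hmin := fun m => Nat.find_min hex (m := m)
  set d := Nat.find hex
  have hcyc : G.IsCycle d (fun k => t (i + k)) := by
    refine ⟨?_, by simpa using he.symm, fun k hk => hs (i + k) (by omega), ?_⟩
    · have hd1 : d ≠ 1 := fun h => (hs i (by omega)).ne (by rw [h] at he; exact he)
      have hd2 : d ≠ 2 := fun h => hb i (by omega) (by rw [h] at he; exact he)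
      omega
    · have key : ∀ a b, a < b → b < d → t (i + a) ≠ t (i + b) := fun a b hab hbd h =>
        hmin (b - a) (by omega) ⟨by omega, i + a, by omega, by
          rw [h]; congr 1; omega⟩
      intro a ha b hb' h
      rcases lt_trichotomy a b with hab | hab | hab
      · exact (key a b hab hb' h).elim
      · exact hab
      · exact (key b a hab ha h.symm).elim
  refine hcyc.girth_le.trans ?_
  exact_mod_cast (by omega : d ≤ N)

/-- Keeps splices simple: most ways for a new edge or arc to be parallel to another one create a
directed triangle through the deleted clique. -/
theorem not_triangle (h4 : (4 : ℕ∞) ≤ G.girth) {a b c : V} (hab : G.Step a b) (hbc : G.Step b c)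
    (hca : G.Step c a) : False := by
  have : G.girth ≤ (3 : ℕ) := by
    refine girth_le_of_closed_walk
      (fun i => if i = 0 then a else if i = 1 then b else if i = 2 then c else a)
      (by omega) (by simp) ?_ ?_
    · intro i hi
      interval_cases i <;> simpa
    · intro i hi
      have : i < 2 := by omega
      interval_cases i
      · simpa using hca.ne.symm
      · simpa using hab.ne.symm
  have := h4.trans this
  exact absurd this (by decide)

/-- Unrolling the cycle lets an argument start at any of its steps. -/
theorem IsCycle.exists_periodic {n : ℕ} {p : ℕ → V} (h : G.IsCycle n p) :
    ∃ q : ℕ → V, (∀ i, q (i + n) = q i) ∧ (∀ i, G.Step (q i) (q (i + 1))) ∧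
      ∀ i j, i < j → j < i + n → q i ≠ q j := by
  obtain ⟨h3, hc, hs, hinj⟩ := h
  have hn : 0 < n := by omega
  refine ⟨fun i => p (i % n), fun i => by simp, fun i => ?_, fun i j hij hj he => ?_⟩
  · have hlt := Nat.mod_lt i hn
    have hstep := hs _ hlt
    have : p ((i + 1) % n) = p (i % n + 1) := by
      rw [← Nat.mod_add_mod]
      by_cases h' : i % n + 1 < n
      · rw [Nat.mod_eq_of_lt h']
      · have : i % n + 1 = n := by omega
        rw [this, Nat.mod_self, hc]
    change G.Step (p (i % n)) (p ((i + 1) % n))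
    rwa [this]
  · have he' := hinj (Nat.mod_lt i hn) (Nat.mod_lt j hn) he
    have h0 := Nat.sub_mod_eq_zero_of_mod_eq he'.symm
    rw [Nat.mod_eq_of_lt (by omega)] at h0
    omega

/-! ### Splices and their degrees. -/

/-- Data for a mixed graph on `W` obtained from `G` by deleting the set `D` of pairwise adjacent
vertices and reconnecting their neighbours: `π` maps `W` to the surviving vertices, edges and arcs
between `same` pairs are inherited from `G`, and every path `a, δ, b` with `δ ∈ D` selected by
`newArc δ` or `newEdge δ` is replaced by a single arc or edge. -/
structure Splice (G : MixedGraph V) (D : Set V) (W : Type u) where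
  π : W → V
  same : W → W → Prop
  newArc : V → W → W → Prop
  newEdge : V → W → W → Prop
  clique : ∀ δ ∈ D, ∀ δ' ∈ D, δ ≠ δ' → G.edges.Adj δ δ'
  π_notMem : ∀ w, π w ∉ D
  same_symm : ∀ a b, same a b → same b a
  same_lift : ∀ a y, y ∉ D → G.underlying.Adj (π a) y → ∃ b, same a b ∧ π b = y
  same_inj : ∀ a b c, same a b → same a c → π b = π c → b = c
  newArc_arc : ∀ δ a b, newArc δ a b → δ ∈ D ∧ G.Arc (π a) δ ∧ G.Arc δ (π b)
  newArc_out : ∀ δ ∈ D, ∀ a, G.Arc (π a) δ → ∃! b, newArc δ a b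
  newArc_in : ∀ δ ∈ D, ∀ b, G.Arc δ (π b) → ∃! a, newArc δ a b
  newArc_label : ∀ δ δ' a b, newArc δ a b → newArc δ' a b → δ = δ'
  newArc_asymm : ∀ δ δ' a b, newArc δ a b → ¬ newArc δ' b a
  newArc_old : ∀ δ a b, newArc δ a b → same a b → ¬ G.underlying.Adj (π a) (π b)
  newEdge_edge : ∀ δ a b, newEdge δ a b → δ ∈ D ∧ G.edges.Adj (π a) δ
  newEdge_symm : ∀ δ a b, newEdge δ a b → newEdge δ b a
  newEdge_ne : ∀ δ a b, newEdge δ a b → a ≠ b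
  newEdge_exists : ∀ δ ∈ D, ∀ a, G.edges.Adj (π a) δ → ∃! b, newEdge δ a b
  newEdge_label : ∀ δ δ' a b, newEdge δ a b → newEdge δ' a b → δ = δ'
  newEdge_old : ∀ δ a b, newEdge δ a b → same a b → ¬ G.underlying.Adj (π a) (π b)
  newArc_newEdge : ∀ δ δ' a b, newArc δ a b → ¬ newEdge δ' a b

theorem ncard_eq_of_rel {α β : Type*} {A : Set α} {B : Set β} (F : α → β → Prop)
    (hA : ∀ a ∈ A, ∃ b ∈ B, F a b) (hB : ∀ b ∈ B, ∃ a ∈ A, F a b)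
    (hr : ∀ a b b', F a b → F a b' → b = b') (hl : ∀ a a' b, F a b → F a' b → a = a') :
    B.ncard = A.ncard := by
  choose f hfB hf using hA
  symm
  refine Set.ncard_congr f hfB ?_ ?_
  · intro a a' ha ha' h
    exact hl a a' (f a ha) (hf a ha) (by rw [h]; exact hf a' ha')
  · intro b hb
    obtain ⟨a, ha, hab⟩ := hB b hb
    exact ⟨a, ha, hr a _ _ (hf a ha) hab⟩

namespace Splice

variable {D : Set V} (s : Splice G D W)

/-- The mixed graph described by a splice. -/
def graph : MixedGraph W where
  edges :=
    { Adj := fun a b => (s.same a b ∧ G.edges.Adj (s.π a) (s.π b)) ∨ ∃ δ, s.newEdge δ a b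
      symm := ⟨by
        rintro a b (⟨h, h'⟩ | ⟨δ, h⟩)
        · exact Or.inl ⟨s.same_symm _ _ h, h'.symm⟩
        · exact Or.inr ⟨δ, s.newEdge_symm _ _ _ h⟩⟩
      loopless := ⟨by
        rintro a (⟨_, h⟩ | ⟨δ, h⟩)
        · exact G.edges.loopless.irrefl _ h
        · exact s.newEdge_ne _ _ _ h rfl⟩ }
  Arc a b := (s.same a b ∧ G.Arc (s.π a) (s.π b)) ∨ ∃ δ, s.newArc δ a b
  arc_asymm := by
    rintro a b (⟨h, h'⟩ | ⟨δ, h⟩) (⟨k, k'⟩ | ⟨δ', k⟩)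
    · exact G.arc_asymm h' k'
    · exact s.newArc_old _ _ _ k (s.same_symm _ _ h) (Or.inr (Or.inr h'))
    · exact s.newArc_old _ _ _ h (s.same_symm _ _ k) (Or.inr (Or.inr k'))
    · exact s.newArc_asymm _ _ _ _ h k
  arc_not_edge := by
    rintro a b (⟨h, h'⟩ | ⟨δ, h⟩) (⟨k, k'⟩ | ⟨δ', k⟩)
    · exact G.arc_not_edge h' k'
    · exact s.newEdge_old _ _ _ k h (Or.inr (Or.inl h'))
    · exact s.newArc_old _ _ _ h k (Or.inl k')
    · exact s.newArc_newEdge _ _ _ _ h k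

/-- Reconnecting preserves the size of a neighbourhood, for any of the three adjacency relations. -/
theorem ncard_neighbors (a : W) (R : V → Prop) (N : V → W → Prop)
    (hR : ∀ y, R y → G.underlying.Adj (s.π a) y) (hN : ∀ δ b, N δ b → δ ∈ D ∧ R δ)
    (hex : ∀ δ ∈ D, R δ → ∃! b, N δ b) (hlab : ∀ δ δ' b, N δ b → N δ' b → δ = δ')
    (hold : ∀ δ b, N δ b → s.same a b → ¬ R (s.π b)) :
    {b : W | (s.same a b ∧ R (s.π b)) ∨ ∃ δ, N δ b}.ncard = {y : V | R y}.ncard := by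
  -- A surviving neighbour corresponds to its lift, a deleted one to the vertex newly joined to `a`
  -- through it.
  refine ncard_eq_of_rel
    (fun y b => (y ∉ D ∧ R y ∧ s.same a b ∧ s.π b = y) ∨ N y b) ?_ ?_ ?_ ?_
  · intro y hy
    by_cases hD : y ∈ D
    · obtain ⟨b, hb, -⟩ := hex y hD hy
      exact ⟨b, Or.inr ⟨y, hb⟩, Or.inr hb⟩
    · obtain ⟨b, hb, rfl⟩ := s.same_lift a y hD (hR y hy)
      exact ⟨b, Or.inl ⟨hb, hy⟩, Or.inl ⟨hD, hy, hb, rfl⟩⟩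
  · rintro b (⟨hb, hy⟩ | ⟨δ, hδ⟩)
    · exact ⟨s.π b, hy, Or.inl ⟨s.π_notMem b, hy, hb, rfl⟩⟩
    · exact ⟨δ, (hN δ b hδ).2, Or.inr hδ⟩
  · rintro y b b' (⟨hD, -, hb, h⟩ | h) (⟨hD', -, hb', h'⟩ | h')
    · exact s.same_inj a b b' hb hb' (h.trans h'.symm)
    · exact absurd (hN _ _ h').1 hD
    · exact absurd (hN _ _ h).1 hD'
    · exact (hex y (hN _ _ h).1 (hN _ _ h).2).unique h h'
  · rintro y y' b (⟨-, hy, hb, h⟩ | h) (⟨-, hy', hb', h'⟩ | h')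
    · exact h.symm.trans h'
    · exact absurd (by rwa [h]) (hold _ _ h' hb)
    · exact absurd (by rwa [h']) (hold _ _ h hb')
    · exact hlab _ _ _ h h'

theorem isRegular {z r : ℕ} (hG : G.IsRegular z r) : s.graph.IsRegular z r := by
  intro a
  obtain ⟨h1, h2, h3⟩ := hG (s.π a)
  refine ⟨?_, ?_, ?_⟩
  · rw [← h1]
    refine s.ncard_neighbors a (fun y => G.Arc (s.π a) y) (fun δ b => s.newArc δ a b)
      (fun y h => Or.inr (Or.inl h)) (fun δ b h => ?_) (fun δ hδ h => s.newArc_out δ hδ a h)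
      (fun δ δ' b => s.newArc_label δ δ' a b)
      (fun δ b h hs h' => s.newArc_old δ a b h hs (Or.inr (Or.inl h')))
    obtain ⟨h, h', -⟩ := s.newArc_arc _ _ _ h
    exact ⟨h, h'⟩
  · rw [← h2]
    have hsymm : ∀ b, s.same b a ↔ s.same a b := fun b =>
      ⟨s.same_symm _ _, s.same_symm _ _⟩
    have := s.ncard_neighbors a (fun y => G.Arc y (s.π a)) (fun δ b => s.newArc δ b a)
      (fun y h => Or.inr (Or.inr h)) (fun δ b h => ?_) (fun δ hδ h => s.newArc_in δ hδ a h)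
      (fun δ δ' b => s.newArc_label δ δ' b a)
      (fun δ b h hs h' => s.newArc_old δ b a h (s.same_symm _ _ hs) (Or.inr (Or.inl h')))
    · rw [← this]
      simp only [graph, hsymm]
    · obtain ⟨h, -, h'⟩ := s.newArc_arc _ _ _ h
      exact ⟨h, h'⟩
  · rw [← h3]
    exact s.ncard_neighbors a (fun y => G.edges.Adj (s.π a) y) (fun δ b => s.newEdge δ a b)
      (fun y h => Or.inl h) (fun δ b h => s.newEdge_edge _ _ _ h)
      (fun δ hδ h => s.newEdge_exists δ hδ a h) (fun δ δ' b => s.newEdge_label δ δ' a b)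
      (fun δ b h hs h' => s.newEdge_old δ a b h hs (Or.inl h'))

/-! ### Cycles in a spliced graph. -/

/-- A step of the spliced graph that is inherited from `G`. -/
def Old (a b : W) : Prop := s.same a b ∧ G.Step (s.π a) (s.π b)

/-- A step of the spliced graph that replaces a path through `δ`. -/
def New (δ : V) (a b : W) : Prop := s.newArc δ a b ∨ s.newEdge δ a b

variable {s}

theorem old_or_new {a b : W} (h : s.graph.Step a b) : s.Old a b ∨ ∃ δ, s.New δ a b := by
  rcases h with (⟨h, h'⟩ | ⟨δ, h⟩) | (⟨h, h'⟩ | ⟨δ, h⟩)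
  · exact Or.inl ⟨h, Or.inl h'⟩
  · exact Or.inr ⟨δ, Or.inr h⟩
  · exact Or.inl ⟨h, Or.inr h'⟩
  · exact Or.inr ⟨δ, Or.inl h⟩

theorem New.mem {δ : V} {a b : W} (h : s.New δ a b) : δ ∈ D := by
  rcases h with h | h
  · exact (s.newArc_arc _ _ _ h).1
  · exact (s.newEdge_edge _ _ _ h).1

theorem New.step_left {δ : V} {a b : W} (h : s.New δ a b) : G.Step (s.π a) δ := by
  rcases h with h | h
  · exact Or.inr (s.newArc_arc _ _ _ h).2.1
  · exact Or.inl (s.newEdge_edge _ _ _ h).2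

theorem New.step_right {δ : V} {a b : W} (h : s.New δ a b) : G.Step δ (s.π b) := by
  rcases h with h | h
  · exact Or.inr (s.newArc_arc _ _ _ h).2.2
  · exact Or.inl (s.newEdge_edge _ _ _ (s.newEdge_symm _ _ _ h)).2.symm

/-- The middle vertex cannot have both an arc from `δ` and another connection to `δ`, so both steps
come from edges, where the partner of `b` is unique. -/
theorem New.back {δ : V} {a b c : W} (h : s.New δ a b) (h' : s.New δ b c) : a = c := by
  rcases h with h | h <;> rcases h' with h' | h'
  · exact absurd (s.newArc_arc _ _ _ h').2.1 (G.arc_asymm (s.newArc_arc _ _ _ h).2.2)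
  · exact absurd (s.newEdge_edge _ _ _ h').2.symm (G.arc_not_edge (s.newArc_arc _ _ _ h).2.2)
  · exact absurd (s.newEdge_edge _ _ _ (s.newEdge_symm _ _ _ h)).2
      (G.arc_not_edge (s.newArc_arc _ _ _ h').2.1)
  · have hb := s.newEdge_symm _ _ _ h
    have he := s.newEdge_edge _ _ _ hb
    exact (s.newEdge_exists δ he.1 b he.2).unique hb h'

theorem New.label {δ δ' : V} {a b : W} (h : s.New δ a b) (h' : s.New δ' a b) : δ = δ' := by
  rcases h with h | h <;> rcases h' with h' | h'
  · exact s.newArc_label _ _ _ _ h h'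
  · exact absurd h' (s.newArc_newEdge _ _ _ _ h)
  · exact absurd h (s.newArc_newEdge _ _ _ _ h')
  · exact s.newEdge_label _ _ _ _ h h'

/-- The part of a walk between two consecutive new steps, closed up through their labels. -/
theorem girth_le_of_segment (q : ℕ → W) {m : ℕ} (hm : 1 ≤ m) {δ δ' : V}
    (h0 : s.New δ (q 0) (q 1)) (hnew : s.New δ' (q m) (q (m + 1)))
    (hold : ∀ i, 1 ≤ i → i < m → s.Old (q i) (q (i + 1))) (hback : ∀ i, q i ≠ q (i + 2)) :
    G.girth ≤ (m + 2 : ℕ) ∧ (δ = δ' → G.girth ≤ (m + 1 : ℕ)) := by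
  -- The walk `δ, π (q 1), …, π (q m), δ'`, of length `m + 1`; if `δ ≠ δ'`, the clique edge back to
  -- `δ` adds one more step.
  let t : ℕ → V := fun i => if i = 0 then δ else if i ≤ m then s.π (q i)
    else if i = m + 1 then δ' else δ
  have ht0 : t 0 = δ := rfl
  have htm : ∀ i, 1 ≤ i → i ≤ m → t i = s.π (q i) := fun i h1 h2 => by
    simp only [t]; rw [if_neg (by omega), if_pos h2]
  have htm1 : t (m + 1) = δ' := by simp [t]
  have htm2 : t (m + 2) = δ := by simp [t]
  have hπ : ∀ w, ∀ d ∈ D, s.π w ≠ d := fun w d hd h => s.π_notMem w (h ▸ hd)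
  have hs : ∀ i < m + 1, G.Step (t i) (t (i + 1)) := by
    intro i hi
    rcases Nat.eq_zero_or_pos i with rfl | hpos
    · rw [ht0, htm 1 le_rfl hm]; exact h0.step_right
    · rcases Nat.lt_or_ge i m with hlt | hge
      · rw [htm i hpos hlt.le, htm (i + 1) (by omega) hlt]; exact (hold i hpos hlt).2
      · obtain rfl : i = m := by omega
        rw [htm i hpos le_rfl, htm1]; exact hnew.step_left
  have hne : m = 1 → δ ≠ δ' := by
    rintro rfl rfl
    exact hback 0 (h0.back hnew)
  have hb : ∀ i, i + 2 ≤ m + 1 → t i ≠ t (i + 2) := by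
    intro i hi
    rcases Nat.eq_zero_or_pos i with rfl | hpos
    · rcases Nat.lt_or_ge 1 m with hlt | hge
      · rw [ht0, htm 2 (by omega) hlt]; exact (hπ _ _ h0.mem).symm
      · obtain rfl : m = 1 := by omega
        rw [ht0]
        exact fun h => hne rfl (h.trans htm1)
    · rcases Nat.lt_or_ge (i + 1) m with hlt | hge
      · rw [htm i hpos (by omega), htm (i + 2) (by omega) hlt]
        intro he
        refine hback i (s.same_inj (q (i + 1)) _ _ (s.same_symm _ _ (hold i hpos (by omega)).1)
          (hold (i + 1) (by omega) hlt).1 he)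
      · obtain rfl : m = i + 1 := by omega
        rw [htm i hpos (by omega), htm1]; exact hπ _ _ hnew.mem
  have hsame : δ = δ' → G.girth ≤ (m + 1 : ℕ) := fun h =>
    girth_le_of_closed_walk t (by omega) (by rw [htm1, ht0, h]) hs hb
  refine ⟨?_, hsame⟩
  by_cases hd : δ = δ'
  · refine (hsame hd).trans ?_
    exact_mod_cast (by omega : m + 1 ≤ m + 2)
  · refine girth_le_of_closed_walk t (by omega) (by rw [htm2, ht0]) ?_ ?_
    · intro i hi
      rcases Nat.lt_or_ge i (m + 1) with hlt | hge
      · exact hs i hlt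
      · obtain rfl : i = m + 1 := by omega
        rw [htm1, htm2]
        exact Or.inl (s.clique _ hnew.mem _ h0.mem (Ne.symm hd))
    · intro i hi
      rcases Nat.lt_or_ge i m with hlt | hge
      · exact hb i (by omega)
      · obtain rfl : i = m := by omega
        rw [htm i hm le_rfl, htm2]; exact hπ _ _ h0.mem

/-- The alternatives are no new step, at least two, or exactly one. With two, two disjoint stretches
of total length at most `n` each cost 2 extra; with one, both ends carry the same label and the cost
is only 1. -/
theorem cycle_cases {n : ℕ} {p : ℕ → W} (h : s.graph.IsCycle n p) :
    G.girth ≤ n ∨ 2 * G.girth ≤ (n + 4 : ℕ) ∨ (G.girth ≤ (n + 1 : ℕ) ∧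
      ∃ q : ℕ → W, q n = q 0 ∧ (∃ δ, s.New δ (q 0) (q 1)) ∧
        ∀ i, 1 ≤ i → i < n → s.Old (q i) (q (i + 1))) := by
  classical
  have h3 := h.1
  obtain ⟨q, hper, hstep, hinj⟩ := h.exists_periodic
  by_cases hall : ∀ i, s.Old (q i) (q (i + 1))
  · left
    refine girth_le_of_closed_walk (fun i => s.π (q i)) (by omega) ?_ (fun i _ => (hall i).2) ?_
    · have := hper 0
      rw [zero_add] at this
      simp [this]
    · intro i _ he
      exact hinj i (i + 2) (by omega) (by omega) (s.same_inj (q (i + 1)) _ _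
        (s.same_symm _ _ (hall i).1) (hall (i + 1)).1 he)
  right
  push Not at hall
  obtain ⟨k, hk⟩ := hall
  have hnext : ∀ k, ¬ s.Old (q k) (q (k + 1)) → ∃ m, 1 ≤ m ∧ m ≤ n ∧
      ¬ s.Old (q (k + m)) (q (k + m + 1)) ∧
      ∀ i, 1 ≤ i → i < m → s.Old (q (k + i)) (q (k + i + 1)) := by
    intro k hk
    have hn : 1 ≤ n ∧ ¬ s.Old (q (k + n)) (q (k + n + 1)) := by
      refine ⟨by omega, ?_⟩
      rwa [hper, show k + n + 1 = k + 1 + n by omega, hper]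
    have hex : ∃ m, 1 ≤ m ∧ ¬ s.Old (q (k + m)) (q (k + m + 1)) := ⟨n, hn⟩
    refine ⟨Nat.find hex, (Nat.find_spec hex).1, Nat.find_le hn, (Nat.find_spec hex).2, ?_⟩
    intro i hi him
    by_contra hno
    exact Nat.find_min hex him ⟨hi, hno⟩
  have hnew : ∀ k, ¬ s.Old (q k) (q (k + 1)) → ∃ δ, s.New δ (q k) (q (k + 1)) := fun k hk =>
    (old_or_new (hstep k)).resolve_left hk
  have hback : ∀ k i, q (k + i) ≠ q (k + (i + 2)) := fun k i =>
    hinj _ _ (by omega) (by omega)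
  obtain ⟨m, hm1, hmn, hm, hmold⟩ := hnext k hk
  obtain ⟨δ, hδ⟩ := hnew k hk
  obtain ⟨δ', hδ'⟩ := hnew _ hm
  have hseg := girth_le_of_segment (fun i => q (k + i)) hm1 hδ hδ' hmold (hback k)
  rcases Nat.lt_or_ge m n with hlt | hge
  · left
    obtain ⟨m', hm1', -, hm', hmold'⟩ := hnext _ hm
    -- By periodicity the step at `k + n` is again new, so the second stretch ends no later.
    have hsum : m + m' ≤ n := by
      by_contra hgt
      have := hmold' (n - m) (by omega) (by omega)
      rw [show k + m + (n - m) = k + n by omega, show k + n + 1 = k + 1 + n by omega,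
        hper, hper] at this
      exact hk this
    obtain ⟨δ'', hδ''⟩ := hnew _ hm'
    have hseg' := girth_le_of_segment (fun i => q (k + m + i)) hm1' hδ' hδ'' hmold' (hback _)
    calc 2 * G.girth = G.girth + G.girth := two_mul _
      _ ≤ (m + 2 : ℕ) + (m' + 2 : ℕ) := add_le_add hseg.1 hseg'.1
      _ ≤ (n + 4 : ℕ) := by exact_mod_cast (by omega : m + 2 + (m' + 2) ≤ n + 4)
  · right
    obtain rfl : m = n := by omega
    -- After a full turn the next new step is the original one.
    have hlab : δ = δ' := by
      refine hδ.label ?_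
      rwa [show k + m + 1 = k + 1 + m by omega, hper, hper] at hδ'
    exact ⟨hseg.2 hlab, fun i => q (k + i), hper k, ⟨δ, hδ⟩, hmold⟩

end Splice
-- Pairings and bijections that avoid old arcs.
theorem exists_matching {X : Set V} (hX : X.Finite) (he : Even X.ncard) :
    ∃ M : V → V → Prop, (∀ a b, M a b → a ∈ X) ∧ (∀ a b, M a b → M b a) ∧
      (∀ a b, M a b → a ≠ b) ∧ ∀ a ∈ X, ∃! b, M a b := by
  obtain ⟨k, hk⟩ := he
  have := hX.to_subtype
  have hcard : Nat.card X = Nat.card (Fin k × Bool) := by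
    rw [Nat.card_coe_set_eq, hk, Nat.card_prod, Nat.card_fin, Nat.card_eq_fintype_card,
      Fintype.card_bool]
    ring
  obtain e : X ≃ Fin k × Bool := (Finite.card_eq.1 hcard).some
  refine ⟨fun a b => ∃ (ha : a ∈ X) (hb : b ∈ X), (e ⟨a, ha⟩).1 = (e ⟨b, hb⟩).1 ∧
    (e ⟨a, ha⟩).2 ≠ (e ⟨b, hb⟩).2, fun a b h => h.1, ?_, ?_, ?_⟩
  · rintro a b ⟨ha, hb, h, h'⟩
    exact ⟨hb, ha, h.symm, h'.symm⟩
  · rintro a b ⟨ha, hb, h, h'⟩ rfl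
    exact h' rfl
  · intro a ha
    refine ⟨e.symm ((e ⟨a, ha⟩).1, !(e ⟨a, ha⟩).2), ⟨ha, Subtype.coe_prop _, by simp, by simp⟩, ?_⟩
    rintro b ⟨_, hb, h, h'⟩
    have : e ⟨b, hb⟩ = ((e ⟨a, ha⟩).1, !(e ⟨a, ha⟩).2) :=
      Prod.ext h.symm (by simpa using Bool.eq_not_of_ne h'.symm)
    rw [← this, e.symm_apply_apply]

/-- Between two sets with one or two elements there is a bijection avoiding any relation that does
not fill a row or a column. -/
theorem exists_bijOn_avoiding {z : ℕ} (hz : z = 1 ∨ z = 2) {X Y : Set V} (hX : X.ncard = z)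
    (hY : Y.ncard = z) (R : V → V → Prop) (hr : ∀ x ∈ X, ∃ y ∈ Y, ¬ R x y)
    (hc : ∀ y ∈ Y, ∃ x ∈ X, ¬ R x y) :
    ∃ σ : V → V, Set.BijOn σ X Y ∧ ∀ x ∈ X, ¬ R x (σ x) := by
  classical
  rcases hz with rfl | rfl
  · obtain ⟨x, rfl⟩ := Set.ncard_eq_one.1 hX
    obtain ⟨y, rfl⟩ := Set.ncard_eq_one.1 hY
    refine ⟨fun _ => y, ?_, by simpa using hr⟩
    simp [Set.BijOn, Set.MapsTo, Set.SurjOn]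
  · obtain ⟨a, b, hab, rfl⟩ := Set.ncard_eq_two.1 hX
    have key : ∀ c d, c ≠ d → Y = {c, d} → ¬ R a c → ¬ R b d →
        ∃ σ : V → V, Set.BijOn σ {a, b} Y ∧ ∀ x ∈ ({a, b} : Set V), ¬ R x (σ x) := by
      rintro c d hcd rfl hac hbd
      refine ⟨fun x => if x = a then c else d, ⟨?_, ?_, ?_⟩, ?_⟩
      · rintro x (rfl | rfl) <;> simp [hab.symm]
      · rintro x (rfl | rfl) y (rfl | rfl) <;> simp [hab.symm, hcd, hcd.symm]
      · rintro y (rfl | rfl)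
        · exact ⟨a, by simp, by simp⟩
        · exact ⟨b, by simp, by simp [hab.symm]⟩
      · rintro x (rfl | rfl)
        · simpa using hac
        · simpa [hab.symm] using hbd
    obtain ⟨c, d, hcd, hYe⟩ := Set.ncard_eq_two.1 hY
    have hra := hr a (by simp)
    have hrb := hr b (by simp)
    have hcc := hc c (by simp [hYe])
    have hcd' := hc d (by simp [hYe])
    simp only [hYe, Set.mem_insert_iff, Set.mem_singleton_iff, exists_eq_or_imp,
      exists_eq_left] at hra hrb hcc hcd'
    -- If one of the two bijections is blocked by an entry of `R`, the other entries of its row and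
    -- column are free, and these form the other bijection.
    by_cases h : ¬ R a c ∧ ¬ R b d
    · exact key c d hcd hYe h.1 h.2
    · exact key d c hcd.symm (hYe.trans (Set.pair_comm _ _)) (by tauto) (by tauto)

theorem exists_mem_notMem_of_ncard [Finite V] {z : ℕ} {A Y : Set V} (hA : A.ncard = z)
    (hY : Y.ncard = z) {v : V} (hv : v ∈ A) (hv' : v ∉ Y) : ∃ y ∈ Y, y ∉ A := by
  by_contra! h
  have := Set.ncard_le_ncard (Set.insert_subset hv h) (Set.toFinite A)
  rw [Set.ncard_insert_of_notMem hv'] at this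
  omega

/-- Equal sizes and two elements of `A` outside `Y` leave at least two elements of `Y` outside `A`;
one of them is not `t`. -/
theorem exists_mem_notMem_of_ncard' [Finite V] {z : ℕ} {A Y : Set V} (hA : A.ncard = z)
    (hY : Y.ncard = z) {u v : V} (huv : u ≠ v) (hu : u ∈ A) (hv : v ∈ A) (hu' : u ∉ Y)
    (hv' : v ∉ Y) (t : V) : ∃ y ∈ Y, y ∉ A ∧ y ≠ t := by
  by_contra! h
  have hsub : insert v Y ⊆ insert t (A \ {u}) := by
    rintro y (rfl | hy)
    · exact Or.inr ⟨hv, huv.symm⟩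
    · by_cases hyA : y ∈ A
      · exact Or.inr ⟨hyA, fun hyu => hu' (hyu ▸ hy)⟩
      · exact Or.inl (h y hy hyA)
  have h1 := Set.ncard_le_ncard hsub (Set.toFinite _)
  have h2 := Set.ncard_insert_le t (A \ {u})
  have h3 := Set.ncard_sdiff_singleton_add_one hu (Set.toFinite A)
  rw [Set.ncard_insert_of_notMem hv'] at h1
  omega

/-! ### Passing to a smaller graph when the girth is too large. -/

/-- Deleting a clique `D` and reconnecting the in-neighbours of each `δ ∈ D` to its out-neighbours
along `σ δ`, and its remaining neighbours in pairs. -/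
theorem nonempty_splice_compl [Finite V] (h4 : (4 : ℕ∞) ≤ G.girth) (D : Set V)
    (hD : ∀ δ ∈ D, ∀ δ' ∈ D, δ ≠ δ' → G.edges.Adj δ δ') (σ : V → V → V)
    (hσ : ∀ δ ∈ D, Set.BijOn (σ δ) {x | G.Arc x δ} {y | G.Arc δ y})
    (hold : ∀ δ ∈ D, ∀ x, G.Arc x δ → ¬ G.Arc x (σ δ x))
    (hlab : ∀ δ ∈ D, ∀ δ' ∈ D, ∀ x, G.Arc x δ → G.Arc x δ' → σ δ x = σ δ' x → δ = δ')
    (heven : ∀ δ ∈ D, Even {w | G.edges.Adj δ w ∧ w ∉ D}.ncard) :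
    Nonempty (Splice G D {w : V // w ∉ D}) := by
  have hM := fun δ => fun hδ : δ ∈ D => exists_matching (Set.toFinite _) (heven δ hδ)
  choose! M hMX hMs hMn hMe using hM
  have hDin : ∀ δ ∈ D, ∀ x, G.Arc x δ → x ∉ D := fun δ hδ x h hx =>
    G.arc_not_edge h (hD x hx δ hδ fun e => (Step.ne (Or.inr h : G.Step x δ)) e)
  have hDout : ∀ δ ∈ D, ∀ x, G.Arc δ x → x ∉ D := fun δ hδ x h hx =>
    G.arc_not_edge h (hD δ hδ x hx fun e => (Step.ne (Or.inr h : G.Step δ x)) e)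
  have hout : ∀ δ ∈ D, ∀ x, G.Arc x δ → G.Arc δ (σ δ x) := fun δ hδ x h => (hσ δ hδ).mapsTo h
  refine ⟨{ π := Subtype.val, same := fun _ _ => True
            newArc := fun δ a b => δ ∈ D ∧ G.Arc a δ ∧ b.1 = σ δ a
            newEdge := fun δ a b => δ ∈ D ∧ M δ a b
            clique := hD, π_notMem := fun w => w.2
            same_symm := fun _ _ h => h
            same_lift := fun a y hy _ => ⟨⟨y, hy⟩, trivial, rfl⟩
            same_inj := fun a b c _ _ h => Subtype.ext h
            newArc_arc := ?_, newArc_out := ?_, newArc_in := ?_, newArc_label := ?_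
            newArc_asymm := ?_, newArc_old := ?_, newEdge_edge := ?_, newEdge_symm := ?_
            newEdge_ne := ?_, newEdge_exists := ?_, newEdge_label := ?_, newEdge_old := ?_
            newArc_newEdge := ?_ }⟩
  · rintro δ a b ⟨hδ, h, h'⟩
    exact ⟨hδ, h, h' ▸ hout δ hδ _ h⟩
  · intro δ hδ a h
    exact ⟨⟨σ δ a, hDout δ hδ _ (hout δ hδ _ h)⟩, ⟨hδ, h, rfl⟩, fun b hb => Subtype.ext hb.2.2⟩
  · intro δ hδ b h
    obtain ⟨x, hx, hxb⟩ := (hσ δ hδ).surjOn h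
    refine ⟨⟨x, hDin δ hδ _ hx⟩, ⟨hδ, hx, hxb.symm⟩, ?_⟩
    rintro c ⟨-, hc, hcb⟩
    exact Subtype.ext ((hσ δ hδ).injOn hc hx (hcb.symm.trans hxb.symm))
  · rintro δ δ' a b ⟨hδ, h, hb⟩ ⟨hδ', h', hb'⟩
    exact hlab δ hδ δ' hδ' a h h' (hb.symm.trans hb')
  · rintro δ δ' a b ⟨hδ, h, hb⟩ ⟨hδ', h', hb'⟩
    have h2 := hout δ hδ _ h
    rw [← hb] at h2
    by_cases e : δ = δ'
    · subst e
      exact G.arc_asymm h2 h'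
    · exact not_triangle h4 (Or.inr h2) (Or.inr h') (Or.inl (hD δ' hδ' δ hδ (Ne.symm e)))
  · rintro δ a b ⟨hδ, h, hb⟩ - hadj
    have h2 := hout δ hδ _ h
    rw [← hb] at h2
    rcases hadj with hadj | hadj | hadj
    · exact not_triangle h4 (Or.inr h) (Or.inr h2) (Or.inl hadj.symm)
    -- An old arc from `a` to `b` closes no directed triangle with the path through `δ`, so the
    -- girth does not exclude it.
    · exact hold δ hδ a h (hb ▸ hadj)
    · exact not_triangle h4 (Or.inr h) (Or.inr h2) (Or.inr hadj)
  · rintro δ a b ⟨hδ, h⟩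
    exact ⟨hδ, (hMX δ hδ _ _ h).1.symm⟩
  · rintro δ a b ⟨hδ, h⟩
    exact ⟨hδ, hMs δ hδ _ _ h⟩
  · rintro δ a b ⟨hδ, h⟩ rfl
    exact hMn δ hδ _ _ h rfl
  · intro δ hδ a h
    obtain ⟨b, hb, hu⟩ := hMe δ hδ a ⟨h.symm, a.2⟩
    exact ⟨⟨b, (hMX δ hδ _ _ (hMs δ hδ _ _ hb)).2⟩, ⟨hδ, hb⟩,
      fun c hc => Subtype.ext (hu _ hc.2)⟩
  · rintro δ δ' a b ⟨hδ, h⟩ ⟨hδ', h'⟩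
    by_contra e
    exact not_triangle h4 (Or.inl (hMX δ hδ _ _ h).1.symm) (Or.inl (hD δ hδ δ' hδ' e))
      (Or.inl (hMX δ' hδ' _ _ h').1)
  · rintro δ a b ⟨hδ, h⟩ - hadj
    have ha := (hMX δ hδ _ _ h).1
    have hb := (hMX δ hδ _ _ (hMs δ hδ _ _ h)).1
    rcases hadj with hadj | hadj | hadj
    · exact not_triangle h4 (Or.inl hadj) (Or.inl hb.symm) (Or.inl ha)
    · exact not_triangle h4 (Or.inr hadj) (Or.inl hb.symm) (Or.inl ha)
    · exact not_triangle h4 (Or.inr hadj) (Or.inl ha.symm) (Or.inl hb)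
  · rintro δ δ' a b ⟨hδ, h, -⟩ ⟨hδ', h'⟩
    have ha := (hMX δ' hδ' _ _ h').1
    by_cases e : δ = δ'
    · subst e
      exact G.arc_not_edge h ha.symm
    · exact not_triangle h4 (Or.inr h) (Or.inl (hD δ hδ δ' hδ' e)) (Or.inl ha)

theorem exists_arc_out {z r : ℕ} (hreg : G.IsRegular z r) (hz : z ≠ 0) (v : V) : ∃ w, G.Arc v w :=
  Set.nonempty_of_ncard_ne_zero ((hreg v).1.trans_ne hz)

/-- An in-neighbour `x` of `u` spends one of its `z` out-arcs on `u` itself, so it misses some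
out-neighbour of `u`; dually for columns. -/
theorem exists_avoiding_of_arc [Finite V] {z r : ℕ} (hz : z = 1 ∨ z = 2) (hreg : G.IsRegular z r)
    (u : V) : ∃ σ : V → V, Set.BijOn σ {x | G.Arc x u} {y | G.Arc u y} ∧
      ∀ x, G.Arc x u → ¬ G.Arc x (σ x) := by
  have hirr : ¬ G.Arc u u := fun h => G.arc_asymm h h
  refine exists_bijOn_avoiding hz (hreg u).2.1 (hreg u).1 G.Arc (fun x hx => ?_) (fun y hy => ?_)
  · exact exists_mem_notMem_of_ncard (A := {y | G.Arc x y}) (hreg x).1 (hreg u).1 hx hirr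
  · exact exists_mem_notMem_of_ncard (A := {x | G.Arc x y}) (hreg y).2.1 (hreg u).2.1 hy hirr

/-- The second condition prevents `u` and `v` from producing the same new arc. If `x` has arcs to
both, it misses two out-neighbours of `v`, one of which differs from `σ x`; dually for columns. -/
theorem exists_avoiding_of_edge [Finite V] {z r : ℕ} (hz : z = 1 ∨ z = 2)
    (hreg : G.IsRegular z r) {u v : V} (huv : G.edges.Adj u v) {σ : V → V}
    (hσ : Set.BijOn σ {x | G.Arc x u} {y | G.Arc u y}) :
    ∃ τ : V → V, Set.BijOn τ {x | G.Arc x v} {y | G.Arc v y} ∧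
      ∀ x, G.Arc x v → ¬ (G.Arc x (τ x) ∨ (G.Arc x u ∧ τ x = σ x)) := by
  have hirr : ¬ G.Arc v v := fun h => G.arc_asymm h h
  have h1 : ¬ G.Arc v u := fun h => G.arc_not_edge h huv.symm
  have h2 : ¬ G.Arc u v := fun h => G.arc_not_edge h huv
  refine exists_bijOn_avoiding hz (hreg v).2.1 (hreg v).1
    (fun x y => G.Arc x y ∨ (G.Arc x u ∧ y = σ x)) (fun x hx => ?_) (fun y hy => ?_)
  · by_cases hxu : G.Arc x u
    · obtain ⟨y, hy, h, h'⟩ := exists_mem_notMem_of_ncard' (A := {y | G.Arc x y}) (hreg x).1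
        (hreg v).1 huv.ne hxu hx h1 hirr (σ x)
      exact ⟨y, hy, fun hh => hh.elim h fun hh => h' hh.2⟩
    · obtain ⟨y, hy, h⟩ := exists_mem_notMem_of_ncard (A := {y | G.Arc x y}) (hreg x).1
        (hreg v).1 hx hirr
      exact ⟨y, hy, fun hh => hh.elim h fun hh => hxu hh.1⟩
  · by_cases hyu : G.Arc u y
    · obtain ⟨t, ht, hty⟩ := hσ.surjOn hyu
      obtain ⟨x, hx, h, h'⟩ := exists_mem_notMem_of_ncard' (A := {x | G.Arc x y}) (hreg y).2.1
        (hreg v).2.1 huv.ne hyu hy h2 hirr t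
      exact ⟨x, hx, fun hh => hh.elim h fun hh =>
        h' (hσ.injOn hh.1 ht (hh.2.symm.trans hty.symm))⟩
    · obtain ⟨x, hx, h⟩ := exists_mem_notMem_of_ncard (A := {x | G.Arc x y}) (hreg y).2.1
        (hreg v).2.1 hy hirr
      exact ⟨x, hx, fun hh => hh.elim h fun hh => hyu (hh.2 ▸ hσ.mapsTo hh.1)⟩

/-- The parity of `r` decides what to delete: the edges leaving `D` at each deleted vertex must be
even in number to be paired, and deleting both ends of an edge turns odd `r` into `r - 1`. -/
theorem exists_deletion [Finite V] [Nonempty V] {z r : ℕ} (hz : z = 1 ∨ z = 2)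
    (hreg : G.IsRegular z r) (h4 : (4 : ℕ∞) ≤ G.girth) :
    ∃ D : Set V, D.Nonempty ∧ Dᶜ.Nonempty ∧ Nonempty (Splice G D {w : V // w ∉ D}) := by
  classical
  obtain ⟨u⟩ := ‹Nonempty V›
  obtain ⟨σ, hσ, hσ'⟩ := exists_avoiding_of_arc hz hreg u
  obtain ⟨w, hw⟩ := exists_arc_out hreg (by omega) u
  have hwu : w ≠ u := (Step.ne (Or.inr hw : G.Step u w)).symm
  rcases Nat.even_or_odd r with he | ho
  · refine ⟨{u}, ⟨u, rfl⟩, ⟨w, hwu⟩, nonempty_splice_compl h4 _ ?_ (fun _ => σ) ?_ ?_ ?_ ?_⟩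
    · rintro _ rfl _ rfl h
      exact (h rfl).elim
    · rintro _ rfl
      exact hσ
    · rintro _ rfl
      exact hσ'
    · rintro _ rfl _ rfl _ _ _ _
      rfl
    · rintro _ rfl
      rw [← (hreg _).2.2] at he
      convert he using 4 with w
      exact and_iff_left_of_imp fun h => h.ne.symm
  · obtain ⟨v, hv⟩ := Set.nonempty_of_ncard_ne_zero ((hreg u).2.2.trans_ne ho.pos.ne')
    have huv : G.edges.Adj u v := hv
    obtain ⟨τ, hτ, hτ'⟩ := exists_avoiding_of_edge hz hreg huv hσ
    have hwv : w ≠ v := by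
      rintro rfl
      exact G.arc_not_edge hw huv
    have hev : ∀ a b : V, G.edges.Adj a b →
        Even {w | G.edges.Adj a w ∧ w ∉ ({a, b} : Set V)}.ncard := by
      intro a b hab
      have h := Set.ncard_sdiff_singleton_add_one (s := {w | G.edges.Adj a w}) hab (Set.toFinite _)
      rw [(hreg a).2.2] at h
      have he : {w | G.edges.Adj a w ∧ w ∉ ({a, b} : Set V)} = {w | G.edges.Adj a w} \ {b} := by
        ext w
        simp only [Set.mem_ofPred_eq, Set.mem_insert_iff, Set.mem_singleton_iff, Set.mem_sdiff]
        exact ⟨fun h => ⟨h.1, fun e => h.2 (Or.inr e)⟩,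
          fun h => ⟨h.1, fun e => e.elim h.1.ne.symm h.2⟩⟩
      rw [he]
      rw [← h] at ho
      simpa [Nat.odd_add_one] using ho
    have hne : v ≠ u := huv.ne.symm
    refine ⟨{u, v}, ⟨u, Or.inl rfl⟩, ⟨w, fun h => h.elim hwu hwv⟩,
      nonempty_splice_compl h4 _ ?_ (fun δ => if δ = u then σ else τ) ?_ ?_ ?_ ?_⟩
    · rintro _ (rfl | rfl) _ (rfl | rfl) h
      · exact (h rfl).elim
      · exact huv
      · exact huv.symm
      · exact (h rfl).elim
    · rintro _ (rfl | rfl)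
      · simpa using hσ
      · simpa [hne] using hτ
    · rintro _ (rfl | rfl)
      · simpa using hσ'
      · simp only [hne, if_false]
        exact fun x hx h => hτ' x hx (Or.inl h)
    · rintro _ (rfl | rfl) _ (rfl | rfl) x hx hx' h
      · rfl
      · simp only [hne, if_true, if_false] at h
        exact (hτ' x hx' (Or.inr ⟨hx, h.symm⟩)).elim
      · simp only [hne, if_true, if_false] at h
        exact (hτ' x hx (Or.inr ⟨hx', h⟩)).elim
      · rfl
    · rintro _ (rfl | rfl)
      · exact hev _ _ huv
      · rw [Set.pair_comm]
        exact hev _ _ huv.symm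

/-- A regular mixed graph whose girth exceeds `g` can be replaced by a smaller one of girth at
least `g`. -/
theorem exists_smaller [Finite V] [Nonempty V] {z r g : ℕ} (hz : z = 1 ∨ z = 2) (hg : 3 ≤ g)
    (hreg : G.IsRegular z r) (hgirth : ((g + 1 : ℕ) : ℕ∞) ≤ G.girth) :
    ∃ (W : Type u) (H : MixedGraph W), Finite W ∧ Nonempty W ∧ H.IsRegular z r ∧
      (g : ℕ∞) ≤ H.girth ∧ Nat.card W < Nat.card V := by
  have h4 : (4 : ℕ∞) ≤ G.girth := le_trans (by exact_mod_cast (by omega : 4 ≤ g + 1)) hgirth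
  obtain ⟨D, ⟨d, hd⟩, ⟨w, hw⟩, ⟨s⟩⟩ := exists_deletion hz hreg h4
  refine ⟨_, s.graph, inferInstance, ⟨⟨w, hw⟩⟩, s.isRegular hreg, le_girth fun n p hp => ?_, ?_⟩
  · have h3 := hp.1
    rcases Splice.cycle_cases hp with h | h | ⟨h, -⟩
    · have := hgirth.trans h
      norm_cast at this
      omega
    · have := (mul_le_mul_right hgirth 2).trans h
      norm_cast at this
      omega
    · have := hgirth.trans h
      norm_cast at this
      omega
  · exact Finite.card_subtype_lt (x := d) (by simpa using hd)

/-- Shrink `H` until its girth is exactly `g`; the order strictly decreases, so this stops.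
Nonemptiness excludes the empty graph, whose girth is `⊤`. -/
theorem IsMixedCage.card_le {z r g : ℕ} (hz : z = 1 ∨ z = 2) (hG : G.IsMixedCage z r g)
    [Finite W] [Nonempty W] (H : MixedGraph W) (hreg : H.IsRegular z r)
    (hgirth : (g : ℕ∞) ≤ H.girth) : Nat.card V ≤ Nat.card W := by
  have hg : 3 ≤ g := by
    have := G.three_le_girth
    rw [hG.1.2.2] at this
    exact_mod_cast this
  induction hn : Nat.card W using Nat.strong_induction_on generalizing W with
  | _ n ih =>
    subst hn
    rcases hgirth.eq_or_lt with h | h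
    · exact hG.2 W H ⟨inferInstance, hreg, h.symm⟩
    · have h' : ((g + 1 : ℕ) : ℕ∞) ≤ H.girth := by
        push_cast
        exact Order.add_one_le_of_lt h
      obtain ⟨W', H', _, _, hreg', hg', hlt⟩ := exists_smaller hz hg hreg h'
      exact (ih _ hlt H' hreg' hg' rfl).trans hlt.le

/-! ### Doubling a part cut off by a vertex. -/

theorem ncard_arcs_eq [Finite V] {z r : ℕ} (hreg : G.IsRegular z r) {S : Set V} {v : V}
    (hv : v ∉ S) (hS : ∀ a ∈ S, ∀ y, y ≠ v → G.underlying.Adj a y → y ∈ S) :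
    {x | x ∈ S ∧ G.Arc x v}.ncard = {y | y ∈ S ∧ G.Arc v y}.ncard := by
  classical
  have := Fintype.ofFinite V
  have hsum := Finset.sum_card_bipartiteAbove_eq_sum_card_bipartiteBelow (s := S.toFinset)
    (t := S.toFinset) G.Arc
  have key : ∀ R : V → Prop, (∀ y, R y → y ≠ v → y ∈ S) → {y | R y}.ncard = z →
      (S.toFinset.filter R).card + (if R v then 1 else 0) = z := by
    intro R hR hz
    rw [Set.ncard_eq_toFinset_card'] at hz
    rw [← hz]
    by_cases hRv : R v
    · rw [if_pos hRv, ← Finset.card_insert_of_notMem (a := v) (by simp [hv])]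
      congr 1
      ext y
      simp only [Finset.mem_insert, Finset.mem_filter, Set.mem_toFinset, Set.mem_ofPred_eq]
      constructor
      · rintro (rfl | h)
        · exact hRv
        · exact h.2
      · intro h
        by_cases e : y = v
        · exact Or.inl e
        · exact Or.inr ⟨hR y h e, h⟩
    · rw [if_neg hRv, add_zero]
      congr 1
      ext y
      simp only [Finset.mem_filter, Set.mem_toFinset, Set.mem_ofPred_eq]
      exact ⟨fun h => h.2, fun h => ⟨hR y h fun e => hRv (e ▸ h), h⟩⟩
  have hout : ∀ x ∈ S.toFinset, (Finset.bipartiteAbove G.Arc S.toFinset x).card +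
      (if G.Arc x v then 1 else 0) = z := fun x hx =>
    key (fun y => G.Arc x y)
      (fun y h hy => hS x (by simpa using hx) y hy (Or.inr (Or.inl h))) (hreg x).1
  have hin : ∀ x ∈ S.toFinset, (Finset.bipartiteBelow G.Arc S.toFinset x).card +
      (if G.Arc v x then 1 else 0) = z := fun x hx =>
    key (fun y => G.Arc y x)
      (fun y h hy => hS x (by simpa using hx) y hy (Or.inr (Or.inr h))) (hreg x).2.1
  -- Count the arcs inside `S` by tails and by heads: both counts are `z|S|` minus the arcs
  -- exchanged with `v` in one direction.
  have h1 := Finset.sum_congr rfl hout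
  have h2 := Finset.sum_congr rfl hin
  rw [Finset.sum_add_distrib, ← Finset.card_filter] at h1 h2
  have h3 : (S.toFinset.filter fun x => G.Arc x v).card =
      (S.toFinset.filter fun x => G.Arc v x).card := by omega
  rw [Set.ncard_eq_toFinset_card', Set.ncard_eq_toFinset_card']
  convert h3 using 2 <;> ext <;> simp

/-- Two copies of a part `S` separated by `v`, joined to each other where `S` was joined to `v`. -/
theorem exists_double [Finite V] {z r : ℕ} (hreg : G.IsRegular z r) {S : Set V} {v : V}
    (hv : v ∉ S) (hS : ∀ a ∈ S, ∀ y, y ≠ v → G.underlying.Adj a y → y ∈ S) :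
    ∃ s : Splice G {v} (S × Bool), (∀ a b, s.same a b → a.2 = b.2) ∧
      ∀ δ a b, s.New δ a b → a.2 ≠ b.2 := by
  have hcard := ncard_arcs_eq hreg hv hS
  have : Nonempty V := ⟨v⟩
  obtain ⟨σ, hσ⟩ := (Set.toFinite {x | x ∈ S ∧ G.Arc x v}).exists_bijOn_of_encard_eq
    (t := {y | y ∈ S ∧ G.Arc v y}) (by
    rw [← (Set.toFinite _).cast_ncard_eq, hcard, (Set.toFinite _).cast_ncard_eq])
  have hout : ∀ x ∈ S, G.Arc x v → σ x ∈ S ∧ G.Arc v (σ x) := fun x hx h => hσ.mapsTo ⟨hx, h⟩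
  refine ⟨{ π := fun a => a.1, same := fun a b => a.2 = b.2
            -- Every new connection switches copies: an arc into `v` is redirected along `σ`, an
            -- edge to `v` becomes an edge between the two twins.
            newArc := fun δ a b => δ = v ∧ a.2 ≠ b.2 ∧ G.Arc a.1 v ∧ b.1.1 = σ a.1
            newEdge := fun δ a b => δ = v ∧ a.2 ≠ b.2 ∧ G.edges.Adj a.1 v ∧ b.1 = a.1
            clique := by
              rintro _ rfl _ rfl h
              exact (h rfl).elim
            π_notMem := fun w h => hv (h ▸ w.1.2)
            same_symm := fun _ _ h => h.symm
            same_lift := fun a y hy h => ⟨(⟨y, hS _ a.1.2 y hy h⟩, a.2), rfl, rfl⟩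
            same_inj := fun a b c h h' e =>
              Prod.ext (Subtype.ext e) (h.symm.trans h')
            newArc_arc := ?_, newArc_out := ?_, newArc_in := ?_, newArc_label := ?_
            newArc_asymm := ?_, newArc_old := ?_, newEdge_edge := ?_, newEdge_symm := ?_
            newEdge_ne := ?_, newEdge_exists := ?_, newEdge_label := ?_, newEdge_old := ?_
            newArc_newEdge := ?_ }, fun _ _ h => h, ?_⟩
  · rintro δ a b ⟨rfl, -, h, h'⟩
    exact ⟨rfl, h, h' ▸ (hout _ a.1.2 h).2⟩
  · rintro _ rfl a h
    refine ⟨(⟨σ a.1, (hout _ a.1.2 h).1⟩, !a.2), ⟨rfl, by simp, h, rfl⟩, ?_⟩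
    rintro b ⟨-, hb, -, hb'⟩
    exact Prod.ext (Subtype.ext hb') (Bool.eq_not_of_ne hb.symm)
  · rintro _ rfl b h
    obtain ⟨x, ⟨hxS, hx⟩, hxb⟩ := hσ.surjOn ⟨b.1.2, h⟩
    refine ⟨(⟨x, hxS⟩, !b.2), ⟨rfl, by simp, hx, hxb.symm⟩, ?_⟩
    rintro c ⟨-, hc, hc', hcb⟩
    exact Prod.ext (Subtype.ext (hσ.injOn ⟨c.1.2, hc'⟩ ⟨hxS, hx⟩ (hcb.symm.trans hxb.symm)))
      (Bool.eq_not_of_ne hc)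
  · rintro δ δ' a b ⟨rfl, -⟩ ⟨rfl, -⟩
    rfl
  · rintro δ δ' a b ⟨rfl, -, h, hb⟩ ⟨rfl, -, h', -⟩
    exact G.arc_asymm h' (hb ▸ (hout _ a.1.2 h).2)
  · rintro δ a b ⟨-, h, -⟩ h'
    exact (h h').elim
  · rintro δ a b ⟨rfl, -, h, -⟩
    exact ⟨rfl, h⟩
  · rintro δ a b ⟨rfl, h, h', h''⟩
    exact ⟨rfl, h.symm, h''.symm ▸ h', h''.symm⟩
  · rintro δ a b ⟨-, h, -⟩ rfl
    exact h rfl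
  · rintro _ rfl a h
    refine ⟨(a.1, !a.2), ⟨rfl, by simp, h, rfl⟩, ?_⟩
    rintro b ⟨-, hb, -, hb'⟩
    exact Prod.ext hb' (Bool.eq_not_of_ne hb.symm)
  · rintro δ δ' a b ⟨rfl, -⟩ ⟨rfl, -⟩
    rfl
  · rintro δ a b ⟨-, h, -⟩ h'
    exact (h h').elim
  · rintro δ δ' a b ⟨rfl, -, h, -⟩ ⟨rfl, -, h', -⟩
    exact G.arc_not_edge h h'
  · rintro δ a b (⟨-, h, -⟩ | ⟨-, h, -⟩) <;> exact h

theorem IsMixedCage.card_le_double {z r g : ℕ} (hz : z = 1 ∨ z = 2) (hG : G.IsMixedCage z r g)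
    {S : Set V} {v : V} (hv : v ∉ S) (hne : S.Nonempty)
    (hS : ∀ a ∈ S, ∀ y, y ≠ v → G.underlying.Adj a y → y ∈ S) : Nat.card V ≤ 2 * S.ncard := by
  obtain ⟨⟨_, hreg, hgirth⟩, -⟩ := id hG
  obtain ⟨s, hsame, hnew⟩ := exists_double hreg hv hS
  have : Nonempty (S × Bool) := ⟨⟨_, hne.some_mem⟩, true⟩
  have h := hG.card_le hz s.graph (s.isRegular hreg) (le_girth fun n p hp => ?_)
  · rwa [Nat.card_prod, Nat.card_coe_set_eq, Nat.card_eq_fintype_card (α := Bool),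
      Fintype.card_bool, mul_comm] at h
  · have h3 := hp.1
    have hc := Splice.cycle_cases hp
    rw [hgirth] at hc
    norm_cast at hc
    rcases hc with h | h | ⟨-, q, hq, ⟨δ, hδ⟩, hold⟩
    · exact h
    -- Here `2g ≤ n + 4`, which gives `g ≤ n` once `g ≥ 4`; for `g ≤ 3` use `n ≥ 3`.
    · omega
    -- A closed walk cannot switch copies exactly once.
    · exfalso
      have hconst : ∀ i, 1 ≤ i → i ≤ n → (q i).2 = (q 1).2 := by
        intro i hi
        induction i, hi using Nat.le_induction with
        | base => exact fun _ => rfl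
        | succ i hi ih => exact fun hn => (hsame _ _ (hold i hi hn).1).symm.trans (ih (by omega))
      exact hnew _ _ _ hδ (hq ▸ hconst n (by omega) le_rfl)

/-- Two distinct components of the rest would each contain at least half of all vertices, yet they
are disjoint and both miss `v`. -/
theorem IsMixedCage.induce_connected {z r g : ℕ} (hz : z = 1 ∨ z = 2) (hG : G.IsMixedCage z r g)
    (v : V) : (G.underlying.induce {w : V | w ≠ v}).Connected := by
  obtain ⟨⟨_, hreg, -⟩, -⟩ := id hG
  obtain ⟨w, hw⟩ := exists_arc_out hreg (by omega) v
  have hwv : w ≠ v := (Step.ne (Or.inr hw : G.Step v w)).symm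
  have : Nonempty {w : V | w ≠ v} := ⟨⟨w, hwv⟩⟩
  refine ⟨?_⟩
  intro a b
  by_contra hab
  set K := G.underlying.induce {w : V | w ≠ v} with hK
  let C : {w : V | w ≠ v} → Set V := fun a => Subtype.val '' {x | K.Reachable a x}
  have hC : ∀ a, v ∉ C a := by
    rintro a ⟨x, -, hx⟩
    exact x.2 hx
  have hcard : ∀ a, Nat.card V ≤ 2 * (C a).ncard := by
    intro a
    refine hG.card_le_double hz (hC a) ⟨a, a, SimpleGraph.Reachable.refl _, rfl⟩ ?_
    rintro _ ⟨x, hx, rfl⟩ y hy hadj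
    refine ⟨⟨y, hy⟩, SimpleGraph.Reachable.trans hx (SimpleGraph.Adj.reachable ?_), rfl⟩
    simpa [hK] using hadj
  have hdisj : Disjoint (C a) (C b) := by
    rw [Set.disjoint_left]
    rintro _ ⟨x, hx, rfl⟩ ⟨y, hy, hyx⟩
    obtain rfl := Subtype.ext hyx
    exact hab (SimpleGraph.Reachable.trans hx hy.symm)
  have h1 := Set.ncard_union_eq hdisj (Set.toFinite _) (Set.toFinite _)
  have h2 : (insert v (C a ∪ C b)).ncard = (C a ∪ C b).ncard + 1 :=
    Set.ncard_insert_of_notMem (fun h => h.elim (hC a) (hC b)) (Set.toFinite _)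
  have h3 := Set.ncard_le_card (insert v (C a ∪ C b))
  have := hcard a
  have := hcard b
  omega

theorem three_le_card [Finite V] (h : G.girth ≠ ⊤) : 3 ≤ Nat.card V := by
  have hex : ∃ n p, G.IsCycle n p := by
    by_contra! hno
    exact h (by simp [girth, hno])
  obtain ⟨n, p, h3, -, -, hinj⟩ := hex
  have h1 := hinj.ncard_image
  have h2 := Set.ncard_le_card (p '' Set.Iio n)
  rw [h1, Set.ncard_eq_toFinset_card', Set.toFinset_Iio, Nat.card_Iio] at h2
  omega

end MixedGraph

theorem mainTheorem2 {V : Type u} (G : MixedGraph V) (z r g : ℕ) (hz : z = 1 ∨ z = 2)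
    (hG : G.IsMixedCage z r g) : IsTwoConnected G.underlying := by
  have hind := hG.induce_connected hz
  obtain ⟨⟨_, hreg, hgirth⟩, -⟩ := hG
  have h3 : 3 ≤ Nat.card V := MixedGraph.three_le_card (G := G) (by simp [hgirth])
  have hne : Nonempty V := (Nat.card_pos_iff.1 (by omega)).1
  refine ⟨h3, ?_, hind⟩
  have key : ∀ v x, G.underlying.Reachable v x := by
    intro v x
    obtain ⟨w, hw⟩ := G.exists_arc_out hreg (by omega) v
    have hvw : G.underlying.Adj v w := Or.inr (Or.inl hw)
    by_cases hx : x = v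
    · rw [hx]
    · exact hvw.reachable.trans (((hind v).preconnected ⟨w, hvw.ne.symm⟩ ⟨x, hx⟩).map
        (SimpleGraph.Embedding.induce _).toHom)
  exact ⟨key⟩
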